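/- Consider the triangular lattice of unit equilateral triangles in the plane, with some lattice lines horizontal. A lozenge is the union of two unit triangles sharing an edge, and a tiling of a finite union of unit triangles (a region) is a covering of it by lozenges contained in it that pairwise overlap at most along their boundaries. Let $a,b,n\ge 0$ be integers, with $b$ and $n$ not both $0$, and let $u_1<u_2<\dots<u_n$ be integers with $1\le u_i\le b+2n$ for all $i\in[n]=\{1,\dots,n\}$. Let $H_{a,b,b,2n}$ be the equiangular hexagonal region of the lattice whose side lengths are $a,\ b+2n,\ b,\ a+2n,\ b,\ b+2n$, in clockwise order starting from the (horizontal) northern side; sides of length $0$ are allowed. Along the northeast border, number from the north the unit triangles inside the hexagon that share an edge with that border, and similarly along the northwest border. Let the dented hexagon $H_{a,b,b,2n,(u_i)_1^n,(u_i)_1^n}$ be the region obtained from $H_{a,b,b,2n}$ by removing, for every $i\in[n]$, the $u_i$th of these triangles along the northeast border and the $u_i$th of these triangles along the northwest border. This region is symmetric across the vertical line $L$ through the midpoint of the northern side; a tiling of it is vertically symmetric if it is invariant under reflection across $L$. Then $H_{a,b,b,2n,(u_i)_1^n,(u_i)_1^n}$ has a vertically symmetric tiling if and only if $a$ is even and $2i\le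 u_i$ for all $i\in[n]$. -/

import Mathlib

namespace TriLattice

/-- A vertex of the triangular lattice. The pair `(i, j)` stands for the point reached from the
origin by `i` unit steps to the east and `j` unit steps to the south-west (direction 240 degrees);
`j` counts the horizontal lattice lines southwards. -/
abbrev Vertex : Type := ℤ × ℤ

/-- The Cartesian coordinates of a lattice vertex (east, north). -/
noncomputable def pos (p : Vertex) : ℝ × ℝ :=
  ((p.1 : ℝ) - (p.2 : ℝ) / 2, -(Real.sqrt 3 / 2) * (p.2 : ℝ))

/-- The unit triangles of the lattice: `up i j` is the up-pointing triangle with top vertex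
`(i, j)`, and `down i j` is the down-pointing triangle with top left vertex `(i, j)`. -/
inductive Triangle : Type
  | up (i j : ℤ) : Triangle
  | down (i j : ℤ) : Triangle
  deriving DecidableEq

/-- The three vertices of a unit triangle. -/
def Triangle.vertices : Triangle → Finset Vertex
  | .up i j => {(i, j), (i, j + 1), (i + 1, j + 1)}
  | .down i j => {(i, j), (i + 1, j), (i + 1, j + 1)}

/-- Two triangles are adjacent if they share an edge, i.e. exactly two vertices. -/
def Triangle.Adjacent (s t : Triangle) : Prop :=
  (s.vertices ∩ t.vertices).card = 2

/-- A lozenge is the union of two adjacent triangles; it is recorded as the set of these two. -/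
def IsLozenge (L : Finset Triangle) : Prop :=
  ∃ s t : Triangle, s.Adjacent t ∧ L = {s, t}

/-- A lozenge tiling of a region `R` (a set of unit triangles): a set of lozenges within `R`,
pairwise not overlapping (no common triangle), which covers `R`. -/
def IsTiling (R : Set Triangle) (T : Set (Finset Triangle)) : Prop :=
  (∀ L ∈ T, IsLozenge L ∧ (L : Set Triangle) ⊆ R) ∧
    T.PairwiseDisjoint id ∧
    ∀ t ∈ R, ∃ L ∈ T, t ∈ L

/-- The lattice vertices of the closed equiangular hexagon with side lengths
`a, b + t, c, a + t, b, c + t`, clockwise from the northern side, whose northern side goes from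
`(0, 0)` to `(a, 0)`. The successive corners are `(0, 0)`, `(a, 0)`, `(a + b + t, b + t)`,
`(a + b + t, b + c + t)`, `(b, b + c + t)`, `(0, c + t)`. The side lines are `j = 0` (north),
`i - j = a` (north-east), `i = a + b + t` (south-east), `j = b + c + t` (south),
`j - i = c + t` (south-west) and `i = 0` (north-west). -/
def hexagonVertices (a b c t : ℕ) : Set Vertex :=
  {p | 0 ≤ p.2 ∧ p.2 ≤ b + c + t ∧ 0 ≤ p.1 ∧ p.1 ≤ a + b + t ∧
    p.1 - p.2 ≤ a ∧ p.2 - p.1 ≤ c + t}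

/-- The hexagonal region: all unit triangles contained in the hexagon. -/
def hexagon (a b c t : ℕ) : Set Triangle :=
  {τ | ∀ p ∈ τ.vertices, p ∈ hexagonVertices a b c t}

/-- The `k`-th (`k ≥ 1`, from the north) triangle sharing an edge with the north-east border
`i - j = a` of the hexagon; the shared edge joins `(a + k - 1, k - 1)` and `(a + k, k)`. -/
def northEastTriangle (a k : ℕ) : Triangle := .up ((a : ℤ) + k - 1) ((k : ℤ) - 1)

/-- The `k`-th (`k ≥ 1`, from the north) triangle sharing an edge with the north-west border
`i = 0` of the hexagon; the shared edge joins `(0, k - 1)` and `(0, k)`. -/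
def northWestTriangle (k : ℕ) : Triangle := .up 0 ((k : ℤ) - 1)

/-- The dented hexagon: the hexagon with the triangles in positions `u i` along the north-east
border and in positions `v j` along the north-west border removed. -/
def dentedHexagon (a b c t : ℕ) {m n : ℕ} (u : Fin m → ℕ) (v : Fin n → ℕ) : Set Triangle :=
  hexagon a b c t \
    (Set.range (fun i => northEastTriangle a (u i)) ∪ Set.range (fun j => northWestTriangle (v j)))

/-- Reflection of lattice vertices across the vertical line through the midpoint of the northern
side of the hexagon, that is, the line at Cartesian abscissa `a / 2`. -/
def reflectVertex (a : ℕ) (p : Vertex) : Vertex := ((a : ℤ) - p.1 + p.2, p.2)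

theorem pos_reflectVertex (a : ℕ) (p : Vertex) :
    pos (reflectVertex a p) = ((a : ℝ) - (pos p).1, (pos p).2) := by
  simp only [pos, reflectVertex, Prod.mk.injEq, and_true]
  push_cast
  ring

/-- The same reflection on unit triangles. -/
def reflect (a : ℕ) : Triangle → Triangle
  | .up i j => .up ((a : ℤ) - i + j) j
  | .down i j => .down ((a : ℤ) - i + j - 1) j

theorem vertices_reflect (a : ℕ) (τ : Triangle) :
    (reflect a τ).vertices = τ.vertices.image (reflectVertex a) := by
  cases τ <;> ext ⟨x, y⟩ <;>
    simp only [reflect, Triangle.vertices, reflectVertex, Finset.mem_image, Finset.mem_insert,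
      Finset.mem_singleton, Prod.mk.injEq, exists_eq_or_imp, exists_eq_left] <;> omega

/-- A set of lozenges is vertically symmetric if it is invariant under this reflection. Since the
reflection is an involution, it suffices that mirror images of members are members. -/
def IsVerticallySymmetric (a : ℕ) (T : Set (Finset Triangle)) : Prop :=
  ∀ L ∈ T, L.image (reflect a) ∈ T

end TriLattice

/-!
Call a lozenge vertical if it crosses a horizontal lattice line. Let `h = b + 2n` be the number of
rows above the longest horizontal line of the hexagon; row `j` lies between the lines `j` and
`j + 1`.

*Necessity.* In a symmetric tiling the mate of a triangle fixed by the reflection is again fixed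
(`reflect_eq_of_mem`), and the only fixed neighbour of a fixed down-pointing triangle is the one
above it (`eq_up_above_of_reflect_eq`). If `a` is odd, the top row contains a fixed down-pointing
triangle with nothing above it, so `a` is even. Then the triangles strictly left of the axis are
matched among themselves, and a down-pointing one within the first `k` rows is matched to an
up-pointing one within the first `k` rows. There are `⌊k / 2⌋` more left up-pointing than left
down-pointing triangles in these rows, before the dents are removed; so at most `⌊k / 2⌋` of the
dents are there (`card_dents_le`). For `k = u i` this gives `2 (i + 1) ≤ u i`.

*Sufficiency.* Let `a = 2m`, and let `e j` be the number of dents in the first `j` rows on one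
side, each row below the line `h` counting as if it had a dent. The tiling has its vertical
lozenges on the line `j` at the `j - 2 e j` consecutive positions centred at the axis; this number
is nonnegative by hypothesis. In each row the remaining triangles to the left of this block
alternate between up and down, as do those to its right, and therefore are matched in exactly one
way. The resulting matching is the function `mate`.
-/

namespace TriLattice

/-! ### Adjacency and membership in the dented hexagon -/

theorem adjacent_comm {s t : Triangle} : s.Adjacent t ↔ t.Adjacent s := by
  rw [Triangle.Adjacent, Triangle.Adjacent, Finset.inter_comm]

theorem down_adjacent_iff {i j : ℤ} {t : Triangle} :
    (Triangle.down i j).Adjacent t ↔ t = .up i j ∨ t = .up (i + 1) j ∨ t = .up i (j - 1) := by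
  constructor
  · intro h
    have h1 : 1 < ((Triangle.down i j).vertices ∩ t.vertices).card := by
      rw [Triangle.Adjacent] at h
      omega
    obtain ⟨⟨x, y⟩, hp, ⟨z, w⟩, hq, hne⟩ := Finset.one_lt_card.1 h1
    cases t with
    | up k l =>
      simp only [Triangle.vertices, Finset.mem_inter, Finset.mem_insert, Finset.mem_singleton,
        Prod.mk.injEq, ne_eq, Triangle.up.injEq] at hp hq hne ⊢
      omega
    | down k l =>
      -- Two vertices determine a down-pointing triangle, so the two triangles would coincide.
      have hkl : k = i ∧ l = j := by
        simp only [Triangle.vertices, Finset.mem_inter, Finset.mem_insert, Finset.mem_singleton,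
          Prod.mk.injEq, ne_eq] at hp hq hne
        omega
      obtain ⟨rfl, rfl⟩ := hkl
      have h3 : (Triangle.down k l).vertices.card = 3 :=
        Finset.card_eq_three.2 ⟨_, _, _, by simp, by simp, by simp, rfl⟩
      rw [Triangle.Adjacent, Finset.inter_self] at h
      omega
  · rintro (rfl | rfl | rfl)
    · have : (Triangle.down i j).vertices ∩ (Triangle.up i j).vertices =
          {(i, j), (i + 1, j + 1)} := by
        ext ⟨x, y⟩
        simp only [Triangle.vertices, Finset.mem_inter, Finset.mem_insert, Finset.mem_singleton,
          Prod.mk.injEq]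
        omega
      rw [Triangle.Adjacent, this, Finset.card_pair (by simp)]
    · have : (Triangle.down i j).vertices ∩ (Triangle.up (i + 1) j).vertices =
          {(i + 1, j), (i + 1, j + 1)} := by
        ext ⟨x, y⟩
        simp only [Triangle.vertices, Finset.mem_inter, Finset.mem_insert, Finset.mem_singleton,
          Prod.mk.injEq]
        omega
      rw [Triangle.Adjacent, this, Finset.card_pair (by simp)]
    · have : (Triangle.down i j).vertices ∩ (Triangle.up i (j - 1)).vertices =
          {(i, j), (i + 1, j)} := by
        ext ⟨x, y⟩
        simp only [Triangle.vertices, Finset.mem_inter, Finset.mem_insert, Finset.mem_singleton,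
          Prod.mk.injEq]
        omega
      rw [Triangle.Adjacent, this, Finset.card_pair (by simp)]

/-- Row `j`, between the horizontal lines `j` and `j + 1`, contains a dent on each side. -/
def HasDent {n : ℕ} (u : Fin n → ℕ) (j : ℤ) : Prop := ∃ k, (u k : ℤ) = j + 1

theorem down_mem_dentedHexagon {a b n : ℕ} {u : Fin n → ℕ} {i j : ℤ} :
    Triangle.down i j ∈ dentedHexagon a b b (2 * n) u u ↔
      0 ≤ j ∧ j < 2 * b + 2 * n ∧ 0 ≤ i ∧ j - i ≤ b + 2 * n ∧ i - j < a ∧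
        i < a + b + 2 * n := by
  simp only [dentedHexagon, hexagon, hexagonVertices, Triangle.vertices, northEastTriangle,
    northWestTriangle, Set.mem_sdiff, Set.mem_ofPred_eq, Finset.mem_insert, Finset.mem_singleton,
    forall_eq_or_imp, forall_eq, Set.mem_union, Set.mem_range, reduceCtorEq, exists_false,
    or_self, not_false_eq_true, and_true]
  push_cast
  omega

theorem up_mem_dentedHexagon {a b n : ℕ} {u : Fin n → ℕ} {i j : ℤ} :
    Triangle.up i j ∈ dentedHexagon a b b (2 * n) u u ↔
      (0 ≤ j ∧ j < 2 * b + 2 * n ∧ 0 ≤ i ∧ j - i < b + 2 * n ∧ i - j ≤ a ∧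
        i < a + b + 2 * n) ∧ (HasDent u j → i ≠ 0 ∧ i ≠ a + j) := by
  have h1 : Triangle.up i j ∈ hexagon a b b (2 * n) ↔
      (0 ≤ j ∧ j < 2 * b + 2 * n ∧ 0 ≤ i ∧ j - i < b + 2 * n ∧ i - j ≤ a ∧
        i < a + b + 2 * n) := by
    simp only [hexagon, hexagonVertices, Triangle.vertices, Set.mem_ofPred_eq, Finset.mem_insert,
      Finset.mem_singleton, forall_eq_or_imp, forall_eq]
    push_cast
    omega
  rw [dentedHexagon, Set.mem_sdiff, h1]
  refine and_congr_right fun _ => ?_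
  simp only [northEastTriangle, northWestTriangle, Set.mem_union, Set.mem_range,
    Triangle.up.injEq]
  constructor
  · rintro h ⟨k, hk⟩
    exact ⟨fun hi => h (Or.inr ⟨k, by omega, by omega⟩),
      fun hi => h (Or.inl ⟨k, by omega, by omega⟩)⟩
  · rintro h (⟨k, hk, hk'⟩ | ⟨k, hk, hk'⟩)
    · exact (h ⟨k, by omega⟩).2 (by omega)
    · exact (h ⟨k, by omega⟩).1 (by omega)

theorem reflect_mem_dentedHexagon {a b n : ℕ} {u : Fin n → ℕ} {t : Triangle}
    (ht : t ∈ dentedHexagon a b b (2 * n) u u) :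
    reflect a t ∈ dentedHexagon a b b (2 * n) u u := by
  cases t with
  | down i j =>
    rw [down_mem_dentedHexagon] at ht
    rw [reflect, down_mem_dentedHexagon]
    omega
  | up i j =>
    rw [up_mem_dentedHexagon] at ht
    rw [reflect, up_mem_dentedHexagon]
    refine ⟨by omega, fun h => ?_⟩
    have := ht.2 h
    omega

/-! ### Tilings and perfect matchings -/

theorem IsTiling.exists_mate {R : Set Triangle} {T : Set (Finset Triangle)} (hT : IsTiling R T)
    {t : Triangle} (ht : t ∈ R) : ∃ s ∈ R, t.Adjacent s ∧ {t, s} ∈ T := by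
  obtain ⟨L, hL, htL⟩ := hT.2.2 t ht
  obtain ⟨⟨x, y, hxy, rfl⟩, hR⟩ := hT.1 L hL
  have hx : x ∈ R := hR (by simp)
  have hy : y ∈ R := hR (by simp)
  rw [Finset.mem_insert, Finset.mem_singleton] at htL
  rcases htL with rfl | h
  · exact ⟨y, hy, hxy, hL⟩
  · subst h
    exact ⟨x, hx, adjacent_comm.1 hxy, by rwa [Finset.pair_comm]⟩

theorem IsTiling.mate_unique {R : Set Triangle} {T : Set (Finset Triangle)} (hT : IsTiling R T)
    {t s s' : Triangle} (hs : {t, s} ∈ T) (hs' : {t, s'} ∈ T) : s = s' := by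
  have h : ({t, s} : Finset Triangle) = {t, s'} := by
    by_contra hne
    exact Finset.disjoint_left.1 (hT.2.1 hs hs' hne) (Finset.mem_insert_self t _)
      (Finset.mem_insert_self t _)
  have h1 : s ∈ ({t, s'} : Finset Triangle) := h ▸ by simp
  have h2 : s' ∈ ({t, s} : Finset Triangle) := h ▸ by simp
  simp only [Finset.mem_insert, Finset.mem_singleton] at h1 h2
  grind

/-- A perfect matching `p` of adjacent triangles of a region, given as an involution, is a
tiling. -/
theorem isTiling_of_involution {R : Set Triangle} (p : Triangle → Triangle)
    (hR : ∀ t ∈ R, p t ∈ R) (hadj : ∀ t ∈ R, t.Adjacent (p t)) (hp : ∀ t ∈ R, p (p t) = t) :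
    IsTiling R {L | ∃ t ∈ R, L = {t, p t}} := by
  refine ⟨?_, ?_, fun t ht => ⟨{t, p t}, ⟨t, ht, rfl⟩, by simp⟩⟩
  · rintro _ ⟨t, ht, rfl⟩
    refine ⟨⟨t, p t, hadj t ht, rfl⟩, ?_⟩
    intro x hx
    simp only [Finset.coe_insert, Finset.coe_singleton, Set.mem_insert_iff,
      Set.mem_singleton_iff] at hx
    rcases hx with rfl | rfl
    exacts [ht, hR t ht]
  · rintro _ ⟨t, ht, rfl⟩ _ ⟨s, hs, rfl⟩ hne
    refine Finset.disjoint_left.2 fun x hx hx' => hne ?_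
    simp only [id, Finset.mem_insert, Finset.mem_singleton] at hx hx'
    have hpt := hp t ht
    have hps := hp s hs
    have hswap : t = p s → ({t, p t} : Finset Triangle) = {s, p s} := by
      rintro rfl
      rw [hps, Finset.pair_comm]
    rcases hx with rfl | rfl <;> rcases hx' with h | h
    · rw [h]
    · exact hswap h
    · exact hswap (by rw [← h, hpt])
    · have : t = s := by rw [← hpt, h, hps]
      rw [this]

/-! ### Necessity -/

section Necessity

variable {a : ℕ} {R : Set Triangle} {T : Set (Finset Triangle)}

/-- In a symmetric tiling the mate of a triangle on the axis lies on the axis. -/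
theorem reflect_eq_of_mem (hT : IsTiling R T) (hsym : IsVerticallySymmetric a T)
    {t s : Triangle} (hts : {t, s} ∈ T) (ht : reflect a t = t) : reflect a s = s := by
  have h := hsym _ hts
  rw [Finset.image_insert, Finset.image_singleton, ht] at h
  exact hT.mate_unique h hts

theorem eq_up_above_of_reflect_eq (hT : IsTiling R T) (hsym : IsVerticallySymmetric a T)
    {i j : ℤ} {s : Triangle} (hadj : (Triangle.down i j).Adjacent s)
    (hs : {Triangle.down i j, s} ∈ T) (hij : 2 * i = a + j - 1) : s = .up i (j - 1) := by
  have hfix : reflect a (.down i j) = .down i j := by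
    simp only [reflect, Triangle.down.injEq, and_true]
    omega
  have h := reflect_eq_of_mem hT hsym hs hfix
  rcases down_adjacent_iff.1 hadj with rfl | rfl | rfl
  · simp only [reflect, Triangle.up.injEq] at h
    omega
  · simp only [reflect, Triangle.up.injEq] at h
    omega
  · rfl

/-- In a symmetric tiling a down-pointing triangle strictly left of the axis has its mate strictly
left of the axis and in no lower row: the only other candidate lies on the axis, and its mate then
does too. -/
theorem mate_left_of_axis (hT : IsTiling R T) (hsym : IsVerticallySymmetric a T)
    {i j : ℤ} {s : Triangle} (hadj : (Triangle.down i j).Adjacent s)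
    (hs : {Triangle.down i j, s} ∈ T) (hij : 2 * i < a + j - 1) :
    ∃ x y : ℤ, s = .up x y ∧ 2 * x < a + y ∧ y ≤ j := by
  rcases down_adjacent_iff.1 hadj with rfl | rfl | rfl
  · exact ⟨_, _, rfl, by omega, by omega⟩
  · refine ⟨_, _, rfl, ?_, by omega⟩
    by_contra hcon
    have hfix : reflect a (.up (i + 1) j) = .up (i + 1) j := by
      simp only [reflect, Triangle.up.injEq, and_true]
      omega
    rw [Finset.pair_comm] at hs
    have h := reflect_eq_of_mem hT hsym hs hfix
    simp only [reflect, Triangle.down.injEq] at h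
    omega
  · exact ⟨_, _, rfl, by omega, by omega⟩

end Necessity

/-- Left of the axis and within the first `k` rows there are `⌊k / 2⌋` more up-pointing than
down-pointing triangles. -/
theorem sum_left_up (m k : ℕ) :
    ∑ r ∈ Finset.range k, (m + (r + 1) / 2) = ∑ r ∈ Finset.range k, (m + r / 2) + k / 2 := by
  induction k with
  | zero => simp
  | succ k ih =>
    rw [Finset.sum_range_succ, Finset.sum_range_succ, ih]
    omega

/-- If the triangles left of the axis (at abscissa `m`) are matched among themselves, then the
dents within the first `k` rows on the western border number at most `⌊k / 2⌋`. The function `f`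
sends the (row, position) pair of a down-pointing triangle to that of its mate; `D` is the set of
the rows of the dents. -/
theorem card_dents_le (m k : ℕ) (f : (Σ _ : ℕ, ℕ) → Σ _ : ℕ, ℕ) (D : Finset ℕ)
    (hD : ∀ r ∈ D, r < k ∧ 0 < m + (r + 1) / 2)
    (hf : ∀ r < k, ∀ x < m + r / 2,
      (f ⟨r, x⟩).1 < k ∧ (f ⟨r, x⟩).2 < m + ((f ⟨r, x⟩).1 + 1) / 2 ∧
        ((f ⟨r, x⟩).1 ∈ D → (f ⟨r, x⟩).2 ≠ 0))
    (hinj : Set.InjOn f {p | p.1 < k ∧ p.2 < m + p.1 / 2}) : D.card ≤ k / 2 := by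
  classical
  set X : Finset (Σ _ : ℕ, ℕ) := (Finset.range k).sigma fun r => Finset.range (m + r / 2) with hX
  set Y : Finset (Σ _ : ℕ, ℕ) :=
    (Finset.range k).sigma fun r => Finset.range (m + (r + 1) / 2) with hY
  set Z : Finset (Σ _ : ℕ, ℕ) := D.map ⟨fun r => ⟨r, 0⟩, fun r s h => by simpa using h⟩ with hZ
  have hXc : X.card = ∑ r ∈ Finset.range k, (m + r / 2) := by simp [hX, Finset.card_sigma]
  have hYc : Y.card = ∑ r ∈ Finset.range k, (m + (r + 1) / 2) := by simp [hY, Finset.card_sigma]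
  have hZY : Z ⊆ Y := by
    intro p hp
    simp only [hZ, Finset.mem_map] at hp
    obtain ⟨r, hr, rfl⟩ := hp
    rw [hY, Finset.mem_sigma, Finset.mem_range, Finset.mem_range]
    exact hD r hr
  have hle : X.card ≤ (Y \ Z).card := by
    refine Finset.card_le_card_of_injOn f ?_ ?_
    · rintro ⟨r, x⟩ hp
      simp only [hX, Finset.coe_sigma, Finset.coe_range, Set.mem_sigma_iff, Set.mem_Iio] at hp
      obtain ⟨h1, h2, h3⟩ := hf r hp.1 x hp.2
      simp only [hY, hZ, Finset.coe_sdiff, Set.mem_sdiff, Finset.mem_coe, Finset.mem_sigma,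
        Finset.mem_range, Finset.mem_map, not_exists, not_and]
      refine ⟨⟨h1, h2⟩, fun s hs hsf => ?_⟩
      rw [← hsf] at h3
      exact h3 hs rfl
    · refine hinj.mono ?_
      rintro ⟨r, x⟩ hp
      simpa [hX] using hp
  rw [Finset.card_sdiff_of_subset hZY] at hle
  have hZc : Z.card = D.card := by simp [hZ]
  have := Finset.card_le_card hZY
  have := sum_left_up m k
  omega

/-- If `a` is odd, the top row has a down-pointing triangle on the axis, which would have to be
matched to a triangle above the hexagon. -/
theorem even_of_isVerticallySymmetric {a b n : ℕ} (hbn : 0 < b + n) {u : Fin n → ℕ}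
    {T : Set (Finset Triangle)} (hT : IsTiling (dentedHexagon a b b (2 * n) u u) T)
    (hsym : IsVerticallySymmetric a T) : Even a := by
  by_contra ha
  obtain ⟨q, rfl⟩ := Nat.not_even_iff_odd.1 ha
  have hmem : Triangle.down q 0 ∈ dentedHexagon (2 * q + 1) b b (2 * n) u u := by
    rw [down_mem_dentedHexagon]
    omega
  obtain ⟨s, hs, hadj, hL⟩ := hT.exists_mate hmem
  obtain rfl := eq_up_above_of_reflect_eq hT hsym hadj hL (by push_cast; omega)
  rw [up_mem_dentedHexagon] at hs
  omega

/-- Counting left of the axis, in the rows down to that of the dent `u i`. -/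
theorem le_of_isVerticallySymmetric {m b n : ℕ} {u : Fin n → ℕ} (hu : StrictMono u)
    (hu_lower : ∀ i, 1 ≤ u i) (hu_upper : ∀ i, u i ≤ b + 2 * n)
    {T : Set (Finset Triangle)} (hT : IsTiling (dentedHexagon (2 * m) b b (2 * n) u u) T)
    (hsym : IsVerticallySymmetric (2 * m) T) (i : Fin n) : 2 * ((i : ℕ) + 1) ≤ u i := by
  classical
  have hn : 0 < n := i.pos
  have hui := hu_upper i
  -- If `m = 0`, a dent in the top row would be the only triangle above the fixed `down 0 1`.
  have hone : m = 0 → ∀ l, u l ≠ 1 := by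
    rintro rfl l hl
    have hmem : Triangle.down 0 1 ∈ dentedHexagon (2 * 0) b b (2 * n) u u := by
      rw [down_mem_dentedHexagon]
      omega
    obtain ⟨s, hs, hadj, hL⟩ := hT.exists_mate hmem
    obtain rfl := eq_up_above_of_reflect_eq hT hsym hadj hL (by simp)
    rw [up_mem_dentedHexagon] at hs
    exact (hs.2 ⟨l, by simp [hl]⟩).1 rfl
  have hmate : ∀ p : (Σ _ : ℕ, ℕ), ∃ q : (Σ _ : ℕ, ℕ), p.1 < u i → p.2 < m + p.1 / 2 →
      q.1 < u i ∧ q.2 < m + (q.1 + 1) / 2 ∧ ((∃ l, u l = q.1 + 1) → q.2 ≠ 0) ∧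
        {Triangle.down p.2 p.1, Triangle.up q.2 q.1} ∈ T := by
    rintro ⟨r, x⟩
    by_cases hrx : r < u i ∧ x < m + r / 2
    · have hmem : Triangle.down x r ∈ dentedHexagon (2 * m) b b (2 * n) u u := by
        rw [down_mem_dentedHexagon]
        push_cast
        omega
      obtain ⟨s, hs, hadj, hL⟩ := hT.exists_mate hmem
      obtain ⟨y, z, rfl, h1, h2⟩ :=
        mate_left_of_axis hT hsym hadj hL (by push_cast; omega)
      rw [up_mem_dentedHexagon] at hs
      obtain ⟨hs, hdent⟩ := hs
      lift y to ℕ using by omega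
      lift z to ℕ using by omega
      push_cast at h1
      refine ⟨⟨z, y⟩, fun _ _ => ⟨by simp only; omega, by simp only; omega, ?_, hL⟩⟩
      rintro ⟨l, hl⟩ hy
      exact (hdent ⟨l, by simp only at hl; omega⟩).1 (by simp only at hy; omega)
    · exact ⟨⟨0, 0⟩, fun h h' => absurd ⟨h, h'⟩ hrx⟩
  choose f hf using hmate
  have hcard : ((Finset.Iic i).image fun l => u l - 1).card = (i : ℕ) + 1 := by
    rw [Finset.card_image_of_injective, Fin.card_Iic]
    intro l l' h
    have := hu_lower l
    have := hu_lower l'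
    exact hu.injective (by simp only at h; omega)
  have key := card_dents_le m (u i) f ((Finset.Iic i).image fun l => u l - 1) ?_ ?_ ?_
  · omega
  · intro r hr
    obtain ⟨l, hl, rfl⟩ := Finset.mem_image.1 hr
    have := hu.monotone (Finset.mem_Iic.1 hl)
    have := hu_lower l
    have := hone
    have : m = 0 → u l ≠ 1 := fun h => hone h l
    omega
  · intro r hr x hx
    obtain ⟨h1, h2, h3, -⟩ := hf ⟨r, x⟩ hr hx
    refine ⟨h1, h2, fun hD => h3 ?_⟩
    obtain ⟨l, -, hl⟩ := Finset.mem_image.1 hD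
    have := hu_lower l
    exact ⟨l, by omega⟩
  · rintro ⟨r, x⟩ hp ⟨r', x'⟩ hp' heq
    have h1 := (hf ⟨r, x⟩ hp.1 hp.2).2.2.2
    have h2 := (hf ⟨r', x'⟩ hp'.1 hp'.2).2.2.2
    rw [heq, Finset.pair_comm] at h1
    rw [Finset.pair_comm] at h2
    have h := hT.mate_unique h1 h2
    simp only [Triangle.down.injEq, Nat.cast_inj] at h
    obtain ⟨rfl, rfl⟩ := h
    rfl

/-! ### Sufficiency -/

/-- The matching of the triangles that is determined by placing vertical lozenges on each
horizontal line `j` at the positions `i` with `m + e j ≤ i ≤ m + j - 1 - e j`. It is meant for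
functions `e` whose increments `e (j + 1) - e j` are `0` or `1`; an increment `1` switches the
orientation of the other lozenges of row `j`. -/
def mate (m : ℤ) (e : ℤ → ℤ) : Triangle → Triangle
  | .down i j =>
    if i < m + e j then .up (i + e (j + 1) - e j) j
    else if i ≤ m + j - 1 - e j then .up i (j - 1)
    else .up (i + 1 - e (j + 1) + e j) j
  | .up i j =>
    if i < m + e (j + 1) then .down (i - e (j + 1) + e j) j
    else if i ≤ m + j - e (j + 1) then .down i (j + 1)
    else .down (i - 1 + e (j + 1) - e j) j

/-- The number of dents in the first `j` rows on one side, where every row below the line `h`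
counts as having one dent. -/
def dentCount {n : ℕ} (u : Fin n → ℕ) (h : ℤ) (j : ℤ) : ℤ :=
  (Finset.univ.filter fun i => (u i : ℤ) ≤ j).card + max 0 (j - h)

section Sufficiency

variable {m b n : ℕ} {u : Fin n → ℕ}

theorem dentCount_of_le (hu_upper : ∀ i, u i ≤ b + 2 * n) {j : ℤ} (hj : (b : ℤ) + 2 * n ≤ j) :
    dentCount u (b + 2 * n) j = j - b - n := by
  have : (Finset.univ.filter fun i => (u i : ℤ) ≤ j) = Finset.univ := by
    refine Finset.filter_true_of_mem fun i _ => ?_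
    have := hu_upper i
    omega
  rw [dentCount, this, Finset.card_univ, Fintype.card_fin]
  omega

theorem dentCount_zero (hu_lower : ∀ i, 1 ≤ u i) : dentCount u (b + 2 * n) 0 = 0 := by
  have : (Finset.univ.filter fun i => (u i : ℤ) ≤ 0) = ∅ := by
    refine Finset.filter_false_of_mem fun i _ => ?_
    have := hu_lower i
    omega
  rw [dentCount, this, Finset.card_empty]
  omega

theorem dentCount_nonneg (j : ℤ) : 0 ≤ dentCount u (b + 2 * n) j := by
  rw [dentCount]
  omega

theorem dentCount_succ_of_dent (hu : StrictMono u) {j : ℤ} (hj : j < b + 2 * n)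
    (h : HasDent u j) :
    dentCount u (b + 2 * n) (j + 1) = dentCount u (b + 2 * n) j + 1 := by
  obtain ⟨k, hk⟩ := h
  have : (Finset.univ.filter fun i => (u i : ℤ) ≤ j + 1) =
      insert k (Finset.univ.filter fun i => (u i : ℤ) ≤ j) := by
    ext i
    simp only [Finset.mem_filter, Finset.mem_univ, true_and, Finset.mem_insert]
    constructor
    · intro hi
      by_cases h : (u i : ℤ) ≤ j
      · exact Or.inr h
      · exact Or.inl (hu.injective (by omega))
    · rintro (rfl | h) <;> omega
  rw [dentCount, dentCount, this, Finset.card_insert_of_notMem (by simp; omega)]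
  push_cast
  omega

theorem dentCount_succ_of_not_dent {j : ℤ} (hj : j < b + 2 * n)
    (h : ¬ HasDent u j) :
    dentCount u (b + 2 * n) (j + 1) = dentCount u (b + 2 * n) j := by
  have : (Finset.univ.filter fun i => (u i : ℤ) ≤ j + 1) =
      Finset.univ.filter fun i => (u i : ℤ) ≤ j := by
    refine Finset.filter_congr fun i _ => ?_
    have : (u i : ℤ) ≠ j + 1 := fun hi => h ⟨i, hi⟩
    omega
  rw [dentCount, dentCount, this]
  omega

theorem two_mul_dentCount_le (hu_upper : ∀ i, u i ≤ b + 2 * n)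
    (hle : ∀ i : Fin n, 2 * ((i : ℕ) + 1) ≤ u i) {j : ℤ} (h0 : 0 ≤ j)
    (hj : j ≤ 2 * b + 2 * n) : 2 * dentCount u (b + 2 * n) j ≤ j := by
  by_cases h : (b : ℤ) + 2 * n ≤ j
  · rw [dentCount_of_le hu_upper h]
    omega
  · -- A dent `i` in the first `j` rows has `i < ⌊j / 2⌋`.
    have hc : (Finset.univ.filter fun i => (u i : ℤ) ≤ j).card ≤ (Finset.range (j / 2).toNat).card :=
      Finset.card_le_card_of_injOn (fun i : Fin n => (i : ℕ))
        (fun i hi => by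
          have := hle i
          simp only [Finset.coe_filter, Finset.mem_univ, true_and, Set.mem_ofPred_eq] at hi
          simp only [Finset.coe_range, Set.mem_Iio]
          omega)
        (fun i _ i' _ hii => Fin.ext hii)
    rw [Finset.card_range] at hc
    rw [dentCount]
    omega

/-- The facts on `e = dentCount u (b + 2 n)` at row `j` that make `mate m e` a matching. -/
theorem dentCount_row (hu : StrictMono u) (hu_lower : ∀ i, 1 ≤ u i)
    (hu_upper : ∀ i, u i ≤ b + 2 * n) (hle : ∀ i : Fin n, 2 * ((i : ℕ) + 1) ≤ u i) {j : ℤ}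
    (h0 : 0 ≤ j) (hj : j < 2 * b + 2 * n) :
    (j = 0 → dentCount u (b + 2 * n) j = 0) ∧ 0 ≤ dentCount u (b + 2 * n) j ∧
      2 * dentCount u (b + 2 * n) j ≤ j ∧ 2 * dentCount u (b + 2 * n) (j + 1) ≤ j + 1 ∧
      ((b : ℤ) + 2 * n ≤ j + 1 → dentCount u (b + 2 * n) (j + 1) = j + 1 - b - n) ∧
      ((j < b + 2 * n ∧ HasDent u j ∧
          dentCount u (b + 2 * n) (j + 1) = dentCount u (b + 2 * n) j + 1) ∨
        (j < b + 2 * n ∧ ¬ HasDent u j ∧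
          dentCount u (b + 2 * n) (j + 1) = dentCount u (b + 2 * n) j) ∨
        (b + 2 * n ≤ j ∧ ¬ HasDent u j ∧
          dentCount u (b + 2 * n) j = j - b - n)) := by
  refine ⟨fun h => by rw [h, dentCount_zero hu_lower], dentCount_nonneg j,
    two_mul_dentCount_le hu_upper hle h0 hj.le,
    two_mul_dentCount_le hu_upper hle (by omega) (by omega), dentCount_of_le hu_upper, ?_⟩
  by_cases hjh : j < b + 2 * n
  · by_cases hk : HasDent u j
    · exact Or.inl ⟨hjh, hk, dentCount_succ_of_dent hu hjh hk⟩
    · exact Or.inr (Or.inl ⟨hjh, hk, dentCount_succ_of_not_dent hjh hk⟩)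
  · refine Or.inr (Or.inr ⟨by omega, ?_, dentCount_of_le hu_upper (by omega)⟩)
    rintro ⟨k, hk⟩
    have := hu_upper k
    omega

/-- On the dented hexagon, `mate` is an involutive matching of adjacent triangles, and it commutes
with the reflection. -/
theorem mate_spec (hu : StrictMono u) (hu_lower : ∀ i, 1 ≤ u i)
    (hu_upper : ∀ i, u i ≤ b + 2 * n) (hle : ∀ i : Fin n, 2 * ((i : ℕ) + 1) ≤ u i)
    {t : Triangle} (ht : t ∈ dentedHexagon (2 * m) b b (2 * n) u u) :
    mate m (dentCount u (b + 2 * n)) t ∈ dentedHexagon (2 * m) b b (2 * n) u u ∧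
      t.Adjacent (mate m (dentCount u (b + 2 * n)) t) ∧
      mate m (dentCount u (b + 2 * n)) (mate m (dentCount u (b + 2 * n)) t) = t ∧
      mate m (dentCount u (b + 2 * n)) (reflect (2 * m) t) =
        reflect (2 * m) (mate m (dentCount u (b + 2 * n)) t) := by
  have row := fun j => @dentCount_row b n u hu hu_lower hu_upper hle j
  generalize dentCount u (b + 2 * n) = e at row ⊢
  cases t with
  | down i j =>
    rw [down_mem_dentedHexagon] at ht
    push_cast at ht
    obtain ⟨h0, hn0, hle0, hle1, htop, hstep⟩ := row j (by omega) (by omega)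
    refine ⟨?_, ?_, ?_, ?_⟩
    · rw [mate]
      split_ifs
      · rw [up_mem_dentedHexagon]
        push_cast
        refine ⟨by omega, fun hk => ?_⟩
        rcases hstep with h | h | h
        · omega
        · exact absurd hk h.2.1
        · exact absurd hk h.2.1
      · -- If row `j - 1` has a dent, then `0 < e j`, so the vertical lozenge avoids the border.
        obtain ⟨-, hn1, -, -, -, hstep1⟩ := row (j - 1) (by omega) (by omega)
        rw [sub_add_cancel] at hstep1
        rw [up_mem_dentedHexagon]
        push_cast
        refine ⟨by omega, fun hk => ?_⟩
        rcases hstep1 with h | h | h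
        · omega
        · exact absurd hk h.2.1
        · exact absurd hk h.2.1
      · rw [up_mem_dentedHexagon]
        push_cast
        refine ⟨by omega, fun hk => ?_⟩
        rcases hstep with h | h | h
        · omega
        · exact absurd hk h.2.1
        · exact absurd hk h.2.1
    · rw [down_adjacent_iff, mate]
      split_ifs <;> simp only [Triangle.up.injEq, and_true, or_true] <;> omega
    · simp only [mate]
      split_ifs <;> simp only [sub_add_cancel] <;> split_ifs <;>
        simp only [Triangle.down.injEq, and_true] <;> omega
    · simp only [reflect, mate]
      split_ifs <;> simp only [Triangle.up.injEq, and_true] <;> push_cast <;> omega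
  | up i j =>
    rw [up_mem_dentedHexagon] at ht
    push_cast at ht
    obtain ⟨h0, hn0, hle0, hle1, htop, hstep⟩ := row j (by omega) (by omega)
    refine ⟨?_, ?_, ?_, ?_⟩
    · obtain ⟨ht, hdent⟩ := ht
      rw [mate]
      rcases hstep with h | h | h
      · have := hdent h.2.1
        split_ifs <;> rw [down_mem_dentedHexagon] <;> push_cast <;> omega
      · split_ifs <;> rw [down_mem_dentedHexagon] <;> push_cast <;> omega
      · split_ifs <;> rw [down_mem_dentedHexagon] <;> push_cast <;> omega
    · rw [adjacent_comm, mate]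
      split_ifs <;> rw [down_adjacent_iff] <;>
        simp only [Triangle.up.injEq, and_true, true_and] <;> omega
    · simp only [mate]
      split_ifs <;> simp only [add_sub_cancel_right] <;> split_ifs <;>
        simp only [Triangle.up.injEq, and_true] <;> omega
    · simp only [reflect, mate]
      split_ifs <;> simp only [Triangle.down.injEq, and_true] <;> push_cast <;> omega

end Sufficiency

end TriLattice

theorem mainTheorem5 (a b n : ℕ) (hbn : 0 < b + n) (u : Fin n → ℕ) (hu : StrictMono u)
    (hu_lower : ∀ i, 1 ≤ u i) (hu_upper : ∀ i, u i ≤ b + 2 * n) :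
    (∃ T : Set (Finset TriLattice.Triangle),
        TriLattice.IsTiling (TriLattice.dentedHexagon a b b (2 * n) u u) T ∧
          TriLattice.IsVerticallySymmetric a T) ↔
      Even a ∧ ∀ i : Fin n, 2 * ((i : ℕ) + 1) ≤ u i := by
  constructor
  · rintro ⟨T, hT, hsym⟩
    have ha := TriLattice.even_of_isVerticallySymmetric hbn hT hsym
    obtain ⟨m, rfl⟩ := ha.two_dvd
    exact ⟨ha, TriLattice.le_of_isVerticallySymmetric hu hu_lower hu_upper hT hsym⟩
  · rintro ⟨ha, hle⟩
    obtain ⟨m, rfl⟩ := ha.two_dvd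
    have spec := fun t => @TriLattice.mate_spec m b n u hu hu_lower hu_upper hle t
    refine ⟨_, TriLattice.isTiling_of_involution
      (TriLattice.mate m (TriLattice.dentCount u (b + 2 * n)))
      (fun t ht => (spec t ht).1) (fun t ht => (spec t ht).2.1)
      (fun t ht => (spec t ht).2.2.1), ?_⟩
    rintro _ ⟨t, ht, rfl⟩
    refine ⟨TriLattice.reflect (2 * m) t, TriLattice.reflect_mem_dentedHexagon ht, ?_⟩
    rw [Finset.image_insert, Finset.image_singleton, (spec t ht).2.2.2]
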